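/- A (real-time) deterministic push-down automaton (DPDA) $M=(Q,\Sigma,\Gamma,\delta,\bot)$ consists of a finite non-empty set $Q$ of states, finite input and stack alphabets $\Sigma,\Gamma$, a bottom symbol $\bot\in\Gamma$, and a transition function $\delta\colon Q\times\Sigma\times\Gamma\to Q\times\Gamma^*$ such that, whenever $\delta(q,a,\gamma)=(q',v)$ and $\bot$ occurs in $v$, then $\gamma=\bot$ and $\bot$ occurs in $v$ only as its first letter. Configurations are pairs $(q,\upsilon)\in Q\times\Gamma^*$, where the top of the stack is the right end of $\upsilon$. Reading $a\in\Sigma$ leads from $(q,\upsilon\gamma)$, $\gamma\in\Gamma$, to $(q',\upsilon v)$, where $\delta(q,a,\gamma)=(q',v)$; a configuration with $\upsilon=\varepsilon$ has no successor. An upstroke (downstroke) is a sequence of successive configurations, induced by an input word, in which no transition decreases (increases) the stack height; a stroke is an upstroke or a downstroke. A word $w\in\Sigma^*$ is a $0$-turn synchronizing word for $M$ in the same stack model if there are $\overline q\in Q$ and $\upsilon\in\Gamma^*$ such that for every $q\in Q$ the word $w$ leads from $(q,\bot)$ to $(\overline q,\upsilon)$ and the induced sequence of configurations is a single stroke. Theorem.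 The problem 0-Turn-Sync-DPDA-Same is undecidable: there is no algorithm that, given a DPDA $M$, decides whether there is a $0$-turn synchronizing word for $M$ in the same stack model. -/

import Mathlib

/-- A real-time deterministic push-down automaton with state set `Q`, input alphabet `A` and stack
alphabet `Γ` (start and final states play no role for synchronization).  `δ q a γ = (q', v)`: in
state `q`, reading `a` with `γ` on top of the stack, go to `q'` and replace `γ` by the word `v`,
whose last letter becomes the new top.  The bottom symbol may be written only as the first letter
of a word replacing the bottom symbol itself (it may be removed). -/
structure DPDA (Q A Γ : Type*) where
  δ : Q → A → Γ → Q × List Γ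
  bot : Γ
  bot_mem : ∀ q a γ, bot ∈ (δ q a γ).2 →
    γ = bot ∧ ∃ v : List Γ, (δ q a γ).2 = bot :: v ∧ bot ∉ v

namespace DPDA

variable {Q A Γ : Type*}

/-- One step from the configuration `(state, stack)`; the top of the stack is the right end of the
list.  There is no successor when the stack is the empty word. -/
def step (M : DPDA Q A Γ) (c : Q × List Γ) (a : A) : Option (Q × List Γ) :=
  match c.2.getLast? with
  | none => none
  | some γ => some ((M.δ c.1 a γ).1, c.2.dropLast ++ (M.δ c.1 a γ).2)

/-- The configuration reached from `c` by reading a word, if the computation does not get stuck. -/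
def run (M : DPDA Q A Γ) : Q × List Γ → List A → Option (Q × List Γ)
  | c, [] => some c
  | c, a :: w => (M.step c a).bind fun c' => M.run c' w

/-- The whole word can be read from `c`, and no transition of the induced sequence of
configurations decreases the stack height. -/
def IsUpstroke (M : DPDA Q A Γ) : Q × List Γ → List A → Prop
  | _, [] => True
  | c, a :: w => ∃ c', M.step c a = some c' ∧ c.2.length ≤ c'.2.length ∧ M.IsUpstroke c' w

/-- The whole word can be read from `c`, and no transition of the induced sequence of
configurations increases the stack height. -/
def IsDownstroke (M : DPDA Q A Γ) : Q × List Γ → List A → Prop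
  | _, [] => True
  | c, a :: w => ∃ c', M.step c a = some c' ∧ c'.2.length ≤ c.2.length ∧ M.IsDownstroke c' w

/-- A stroke is an upstroke or a downstroke. -/
def IsStroke (M : DPDA Q A Γ) (c : Q × List Γ) (w : List A) : Prop :=
  M.IsUpstroke c w ∨ M.IsDownstroke c w

/-- The sequence of configurations induced by `w` from `c` can be split into at most `n` strokes
(a stroke may be trivial, hence "at most"). -/
def SplitsIntoStrokes (M : DPDA Q A Γ) : ℕ → Q × List Γ → List A → Prop
  | 0, _, w => w = []
  | n + 1, c, w => ∃ u v c', w = u ++ v ∧ M.IsStroke c u ∧ M.run c u = some c' ∧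
      M.SplitsIntoStrokes n c' v

/-- `w` is an `n`-turn synchronizing word in the same stack model: started in any state with only
the bottom symbol on the stack, `w` leads to one and the same state with one and the same stack
content, and each of these runs consists of at most `n + 1` strokes. -/
def IsTurnSyncWordSame (M : DPDA Q A Γ) (n : ℕ) (w : List A) : Prop :=
  ∃ (p : Q) (υ : List Γ), ∀ q : Q,
    M.run (q, [M.bot]) w = some (p, υ) ∧ M.SplitsIntoStrokes (n + 1) (q, [M.bot]) w

/-- The question of the problem `n`-Turn-Sync-DPDA-Same. -/
def TurnSyncSame (n : ℕ) (M : DPDA Q A Γ) : Prop :=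
  ∃ w : List A, M.IsTurnSyncWordSame n w

/-- Finite descriptions of DPDAs: the numbers of states, of input letters and of stack letters, the
bottom symbol, and the transition table. -/
abbrev Code : Type := (ℕ × ℕ × ℕ × ℕ) × List (List (List (ℕ × List ℕ)))

/-- The description of a DPDA whose states, input letters and stack letters are numbered; the entry
of the table at position `q`, `a`, `γ` is `δ q a γ`. -/
def code {k m g : ℕ} (M : DPDA (Fin k) (Fin m) (Fin g)) : Code :=
  ((k, m, g, M.bot),
    List.ofFn fun q => List.ofFn fun a => List.ofFn fun γ =>
      (((M.δ q a γ).1 : ℕ), (M.δ q a γ).2.map fun x => (x : ℕ)))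

end DPDA

/-! Halting of a Turing machine is reduced to synchronization through string rewriting. Rules acting
on words of configurations derive a single halting letter exactly when the machine halts
(`eval_dom_iff`). A derivation is in turn a match in the style of Post's correspondence problem
(`exists_tiles_iff`): the left sides of the tiles spell the successive words, separated by `none`,
while the right sides spell the same sequence one word ahead; copy rules carry unchanged letters
along.

The automaton has two states. On the tiles named by the input, state 0 pushes left sides and state 1
right sides; a finishing letter merges the states and freezes the stack. Hence synchronization means
equality of the two pushed words (`turnSyncSame_toDPDA_iff`). The stack never shrinks, so every run
is an upstroke and the turn bound costs nothing.

The machine is fixed, with an undecidable halting set (`exists_code_not_computablePred`,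
`exists_machine`). Only its input varies, which affects a single table entry, so the reduction is
computable. -/

/-! ### String rewriting and tile words -/

/-- One rewriting step with the rules `l i → r i`. -/
def RewriteStep {ι S : Type*} (l r : ι → List S) (x y : List S) : Prop :=
  ∃ p i s, x = p ++ l i ++ s ∧ y = p ++ r i ++ s

/-- The words of the tiles given by one side of the rules; `none` is the tile of the separator. -/
def tileWord {ι S : Type*} (l : ι → List S) : Option ι → List (Option S)
  | none => [none]
  | some i => (l i).map some

section Tiles

variable {ι S : Type*} {l r : ι → List S}

/-- The separator does not occur in `u.map some`, so `u` ends before the first separator on the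
right. -/
theorem exists_eq_append_of_map_some_append_eq {u x : List S} {t v : List (Option S)}
    (h : u.map some ++ t = x.map some ++ none :: v) :
    ∃ x', x = u ++ x' ∧ t = x'.map some ++ none :: v := by
  induction u generalizing x with
  | nil => exact ⟨x, rfl, h⟩
  | cons a u ih =>
    cases x with
    | nil => simp at h
    | cons b x =>
      simp only [List.map_cons, List.cons_append, List.cons.injEq, Option.some.injEq] at h
      obtain ⟨x', rfl, h'⟩ := ih h.2
      exact ⟨x', by simp [h.1], h'⟩

/-- In a match of tile words, `x` is what is left of the current word, and `y` is what has been
produced of the next word. -/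
theorem reflTransGen_rewriteStep_of_tiles {y₀ : List S} (A : List (Option ι)) (x y : List S)
    (h : A.flatMap (tileWord l) ++ (y₀.map some ++ [none]) =
      x.map some ++ none :: (y.map some ++ A.flatMap (tileWord r))) :
    Relation.ReflTransGen (RewriteStep l r) (y ++ x) y₀ := by
  induction A generalizing x y with
  | nil =>
    obtain ⟨x', rfl, h'⟩ := exists_eq_append_of_map_some_append_eq h
    cases x' with
    | nil =>
      have : y = [] := by simpa using h'
      subst this
      simp [Relation.ReflTransGen.refl]
    | cons b x' => simp at h'
  | cons t A ih =>
    cases t with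
    | none =>
      cases x with
      | nil =>
        have := ih y [] (by simpa [tileWord] using h)
        simpa using this
      | cons b x => simp [tileWord] at h
    | some i =>
      rw [List.flatMap_cons, List.append_assoc] at h
      obtain ⟨x', rfl, h'⟩ := exists_eq_append_of_map_some_append_eq h
      have := ih x' (y ++ r i) (by simpa [tileWord] using h')
      -- The tile consumes `l i` at the front of `x` and adds `r i` at the end of `y`, which
      -- rewrites `y ++ x` in place.
      refine Relation.ReflTransGen.head ⟨y, i, x', by simp, rfl⟩ ?_
      simpa using this

theorem exists_copy_tiles (hcopy : ∀ a, ∃ i, l i = [a] ∧ r i = [a]) (p : List S) :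
    ∃ A : List (Option ι), A.flatMap (tileWord l) = p.map some ∧
      A.flatMap (tileWord r) = p.map some := by
  induction p with
  | nil => exact ⟨[], rfl, rfl⟩
  | cons a p ih =>
    obtain ⟨A, h₁, h₂⟩ := ih
    obtain ⟨i, hl, hr⟩ := hcopy a
    exact ⟨some i :: A, by simp [tileWord, hl, h₁], by simp [tileWord, hr, h₂]⟩

/-- Each rewriting step becomes one round of tiles: copy the prefix, apply the rule, copy the
suffix, then place the separator. -/
theorem exists_tiles_of_reflTransGen (hcopy : ∀ a, ∃ i, l i = [a] ∧ r i = [a]) {x y₀ : List S}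
    (h : Relation.ReflTransGen (RewriteStep l r) x y₀) :
    ∃ A : List (Option ι), A.flatMap (tileWord l) ++ (y₀.map some ++ [none]) =
      x.map some ++ none :: A.flatMap (tileWord r) := by
  induction h using Relation.ReflTransGen.head_induction_on with
  | refl => exact ⟨[], by simp⟩
  | head hstep _ ih =>
    obtain ⟨p, i, s, rfl, rfl⟩ := hstep
    obtain ⟨A, hA⟩ := ih
    obtain ⟨P, hP, hP'⟩ := exists_copy_tiles hcopy p
    obtain ⟨T, hT, hT'⟩ := exists_copy_tiles hcopy s
    refine ⟨P ++ some i :: T ++ none :: A, ?_⟩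
    simp only [List.flatMap_append, List.flatMap_cons, hP, hP', hT, hT', List.append_assoc, hA]
    simp [tileWord]

/-- A word rewrites to another one if and only if a match of the tiles exists. -/
theorem exists_tiles_iff (hcopy : ∀ a, ∃ i, l i = [a] ∧ r i = [a]) (x y₀ : List S) :
    (∃ A : List (Option ι), A.flatMap (tileWord l) ++ (y₀.map some ++ [none]) =
      x.map some ++ none :: A.flatMap (tileWord r)) ↔
    Relation.ReflTransGen (RewriteStep l r) x y₀ :=
  ⟨fun ⟨A, h⟩ => by simpa using reflTransGen_rewriteStep_of_tiles A x [] (by simpa using h),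
    exists_tiles_of_reflTransGen hcopy⟩

end Tiles

/-! ### A push-down automaton that writes tile words -/

namespace TileDPDA

/-- The words pushed at the start, for each tile, and at the end, in each of the two states. -/
structure Words (T S : Type*) where
  start : Fin 2 → List S
  tile : Fin 2 → T → List S
  final : Fin 2 → List S

variable {T S : Type*}

namespace Words

variable (W : Words T S)

/-- The reaction of the automaton to a letter (`none` starts, `some none` ends) and a top of the
stack (`none` is the bottom symbol, `some none` the mark of a finished stack). -/
def emit (q : Fin 2) : Option (Option T) → Option (Option S) → Fin 2 × List (Option S)
  | none, none => (q, (W.start q).map some)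
  | some none, some (some _) => (1, (W.final q).map some ++ [none])
  | some (some t), some (some _) => (q, (W.tile q t).map some)
  | _, _ => (q, [])

/-- The successor of a state and a stack without its bottom symbol. -/
def next (c : Fin 2 × List (Option S)) (a : Option (Option T)) : Fin 2 × List (Option S) :=
  ((W.emit c.1 a c.2.getLast?).1, c.2 ++ (W.emit c.1 a c.2.getLast?).2)

theorem exists_getLast?_map_some {L : List S} (h : L ≠ []) :
    ∃ s, (L.map some).getLast? = some (some s) := by
  rw [List.getLast?_map, List.getLast?_eq_getLast_of_ne_nil h]
  exact ⟨_, rfl⟩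

theorem next_tile {q : Fin 2} {L : List S} (h : L ≠ []) (t : T) :
    W.next (q, L.map some) (some (some t)) = (q, (L ++ W.tile q t).map some) := by
  obtain ⟨s, hs⟩ := exists_getLast?_map_some h
  simp [next, hs, emit]

theorem next_final {q : Fin 2} {L : List S} (h : L ≠ []) :
    W.next (q, L.map some) (some none) = (1, (L ++ W.final q).map some ++ [none]) := by
  obtain ⟨s, hs⟩ := exists_getLast?_map_some h
  simp [next, hs, emit]

theorem next_start {q : Fin 2} {L : List S} (h : L ≠ []) :
    W.next (q, L.map some) none = (q, L.map some) := by
  obtain ⟨s, hs⟩ := exists_getLast?_map_some h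
  simp [next, hs, emit]

theorem next_finished (q : Fin 2) (L : List (Option S)) (a : Option (Option T)) :
    W.next (q, L ++ [none]) a = (q, L ++ [none]) := by
  rcases a with _ | _ | a <;> simp [next, emit]

theorem foldl_next_tiles {q : Fin 2} {L : List S} (h : L ≠ []) (A : List T) :
    (A.map fun t => some (some t)).foldl W.next (q, L.map some) =
      (q, (L ++ A.flatMap (W.tile q)).map some) := by
  induction A generalizing L with
  | nil => simp
  | cons t A ih =>
    rw [List.map_cons, List.foldl_cons, next_tile W h, ih (by simp [h])]
    simp

/-- The two runs on a word are in the same phase. -/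
theorem foldl_next_cases (hs : ∀ q, W.start q ≠ []) (w : List (Option (Option T))) :
    (∀ q, w.foldl W.next (q, []) = (q, [])) ∨
    (∃ A : List T, ∀ q, w.foldl W.next (q, []) = (q, (W.start q ++ A.flatMap (W.tile q)).map some)) ∨
    (∃ A : List T, ∀ q, w.foldl W.next (q, []) =
      (1, (W.start q ++ A.flatMap (W.tile q) ++ W.final q).map some ++ [none])) := by
  induction w using List.reverseRecOn with
  | nil => exact Or.inl fun _ => rfl
  | append_singleton w a ih =>
    simp only [List.foldl_append, List.foldl_cons, List.foldl_nil]
    -- The top of the stack reveals the phase: the bottom symbol, a proper letter, or the final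
    -- mark.
    rcases ih with h | ⟨A, h⟩ | ⟨A, h⟩
    · rcases a with _ | _ | t
      · exact Or.inr (Or.inl ⟨[], fun q => by simp [h, next, emit]⟩)
      · exact Or.inl fun q => by simp [h, next, emit]
      · exact Or.inl fun q => by simp [h, next, emit]
    · have hne : ∀ q, W.start q ++ A.flatMap (W.tile q) ≠ [] := by simp [hs]
      rcases a with _ | _ | t
      · exact Or.inr (Or.inl ⟨A, fun q => by rw [h, next_start W (hne q)]⟩)
      · exact Or.inr (Or.inr ⟨A, fun q => by rw [h, next_final W (hne q)]⟩)
      · exact Or.inr (Or.inl ⟨A ++ [t], fun q => by rw [h, next_tile W (hne q)]; simp⟩)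
    · exact Or.inr (Or.inr ⟨A, fun q => by rw [h, next_finished]⟩)

theorem exists_foldl_next_eq_iff (hs : ∀ q, W.start q ≠ []) :
    (∃ w : List (Option (Option T)), w.foldl W.next (0, []) = w.foldl W.next (1, [])) ↔
    ∃ A : List T, W.start 0 ++ A.flatMap (W.tile 0) ++ W.final 0 =
      W.start 1 ++ A.flatMap (W.tile 1) ++ W.final 1 := by
  constructor
  · rintro ⟨w, hw⟩
    rcases W.foldl_next_cases hs w with h | ⟨A, h⟩ | ⟨A, h⟩
    -- Before the finishing letter each run keeps its own state, so the two runs differ.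
    · simp [h] at hw
    · simp [h] at hw
    · rw [h, h] at hw
      exact ⟨A, List.map_injective_iff.2 (Option.some_injective S)
        (List.append_cancel_right (Prod.ext_iff.1 hw).2)⟩
  · rintro ⟨A, hA⟩
    refine ⟨none :: (A.map fun t => some (some t)) ++ [some none], ?_⟩
    have key : ∀ q, (none :: (A.map fun t => some (some t)) ++ [some none]).foldl W.next (q, []) =
        (1, (W.start q ++ A.flatMap (W.tile q) ++ W.final q).map some ++ [none]) := by
      intro q
      have h₀ : W.next (q, []) none = (q, (W.start q).map some) := by simp [next, emit]
      simp only [List.foldl_append, List.foldl_cons, List.foldl_nil, h₀]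
      rw [foldl_next_tiles W (hs q), next_final W (by simp [hs q])]
    rw [key, key, hA]

variable {m g : ℕ} (eA : Fin m ≃ Option (Option T)) (eΓ : Fin g ≃ Option (Option S))

/-- The automaton with two states that writes the tile words of each state. -/
def toDPDA : DPDA (Fin 2) (Fin m) (Fin g) where
  δ q a γ := ((W.emit q (eA a) (eΓ γ)).1,
    -- The letter just read is put back first, so the height never drops and the bottom symbol stays
    -- in place.
    γ :: (W.emit q (eA a) (eΓ γ)).2.map fun s => eΓ.symm (some s))
  bot := eΓ.symm none
  bot_mem := by
    intro q a γ h
    have hn : ∀ L : List (Option S), eΓ.symm none ∉ L.map fun s => eΓ.symm (some s) := by simp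
    obtain rfl | h := List.mem_cons.1 h
    · exact ⟨rfl, _, rfl, hn _⟩
    · exact absurd h (hn _)

/-- The stack with a given content above its bottom symbol. -/
def stack (L : List (Option S)) : List (Fin g) :=
  eΓ.symm none :: L.map fun s => eΓ.symm (some s)

theorem stack_injective : Function.Injective (stack eΓ) := by
  intro L L' h
  exact List.map_injective_iff.2 (fun a b h => by simpa using h) (List.cons.inj h).2

theorem step_stack (q : Fin 2) (L : List (Option S)) (a : Fin m) :
    (W.toDPDA eA eΓ).step (q, stack eΓ L) a =
      some ((W.next (q, L) (eA a)).1, stack eΓ (W.next (q, L) (eA a)).2) := by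
  have h : ∃ γ, (stack eΓ L).getLast? = some γ ∧ eΓ γ = L.getLast? ∧
      (stack eΓ L).dropLast ++ [γ] = stack eΓ L := by
    refine ⟨(stack eΓ L).getLast (by simp [stack]), List.getLast?_eq_getLast_of_ne_nil _, ?_,
      List.dropLast_append_getLast _⟩
    rcases List.eq_nil_or_concat L with rfl | ⟨L, s, rfl⟩
    · simp [stack]
    · simp [stack]
  obtain ⟨γ, h₁, h₂, h₃⟩ := h
  have : ∀ v, (stack eΓ L).dropLast ++ γ :: v = stack eΓ L ++ v := by
    intro v
    conv_rhs => rw [← h₃]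
    simp
  simp only [DPDA.step, h₁, toDPDA, this, h₂, next]
  simp [stack]

theorem run_stack (w : List (Fin m)) (q : Fin 2) (L : List (Option S)) :
    (W.toDPDA eA eΓ).run (q, stack eΓ L) w =
      some (((w.map eA).foldl W.next (q, L)).1, stack eΓ ((w.map eA).foldl W.next (q, L)).2) := by
  induction w generalizing q L with
  | nil => rfl
  | cons a w ih =>
    rw [DPDA.run, step_stack, Option.bind_some, ih]
    rfl

theorem isUpstroke_stack (w : List (Fin m)) (q : Fin 2) (L : List (Option S)) :
    (W.toDPDA eA eΓ).IsUpstroke (q, stack eΓ L) w := by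
  induction w generalizing q L with
  | nil => trivial
  | cons a w ih => exact ⟨_, step_stack W eA eΓ q L a, by simp [stack, next], ih _ _⟩

theorem turnSyncSame_toDPDA_iff (hs : ∀ q, W.start q ≠ []) :
    (W.toDPDA eA eΓ).TurnSyncSame 0 ↔
    ∃ A : List T, W.start 0 ++ A.flatMap (W.tile 0) ++ W.final 0 =
      W.start 1 ++ A.flatMap (W.tile 1) ++ W.final 1 := by
  rw [← W.exists_foldl_next_eq_iff hs]
  have hbot : [(W.toDPDA eA eΓ).bot] = stack eΓ [] := rfl
  constructor
  · rintro ⟨w, p, υ, h⟩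
    have h₀ := (h 0).1
    have h₁ := (h 1).1
    rw [hbot, run_stack, Option.some_inj, Prod.mk.injEq] at h₀ h₁
    exact ⟨w.map eA, Prod.ext (h₀.1.trans h₁.1.symm)
      (stack_injective eΓ (h₀.2.trans h₁.2.symm))⟩
  · rintro ⟨w, hw⟩
    obtain ⟨w, rfl⟩ : ∃ w', w = w'.map eA := ⟨w.map eA.symm, by simp⟩
    refine ⟨w, ((w.map eA).foldl W.next (0, [])).1,
      stack eΓ ((w.map eA).foldl W.next (0, [])).2, fun q => ?_⟩
    have hq : (w.map eA).foldl W.next (q, []) = (w.map eA).foldl W.next (0, []) := by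
      fin_cases q
      · rfl
      · exact hw.symm
    have hrun := run_stack W eA eΓ w q []
    rw [hq] at hrun
    exact ⟨hrun, w, [], _, by simp, Or.inl (isUpstroke_stack W eA eΓ w q []), hrun, rfl⟩

end Words

end TileDPDA

/-! ### Turing machines as string rewriting systems -/

namespace TMRewriting

open Turing Relation

/-- The letters of words that describe configurations of a Turing machine. -/
inductive Letter (Γ Λ : Type*)
  | border
  | halted
  | tape (a : Γ)
  | state (q : Λ)

open Letter

instance {Γ Λ : Type*} [Finite Γ] [Finite Λ] : Finite (Letter Γ Λ) :=
  Finite.of_injective (β := Option (Option (Γ ⊕ Λ)))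
    (fun
      | .border => none
      | .halted => some none
      | .tape a => some (some (.inl a))
      | .state q => some (some (.inr q)))
    (by rintro (_ | _ | _ | _) (_ | _ | _ | _) h <;> simp_all)

variable {Γ Λ : Type*} {S : Set Λ}

/-- The word of a configuration with state `q`, the tape `l` to the left of the head (reversed), and
the tape `r` from the head on. -/
def cfgWord (q : S) (l r : List Γ) : List (Letter Γ S) :=
  (border :: l.reverse.map tape) ++ state q :: (r.map tape ++ [border])

/-- A state in the word of a configuration is the state of the configuration. -/
theorem eq_of_cfgWord_eq {q q' : S} {l r : List Γ} {p s : List (Letter Γ S)}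
    (h : cfgWord q l r = p ++ state q' :: s) :
    q' = q ∧ border :: l.reverse.map tape = p ∧ r.map tape ++ [border] = s := by
  rw [cfgWord, List.append_cons_inj_of_notMem (by simp) (by simp)] at h
  exact ⟨by simpa using h.2.1.symm, h.1, h.2.2⟩

theorem halted_notMem_cfgWord (q : S) (l r : List Γ) : halted ∉ cfgWord q l r := by
  simp [cfgWord]

variable [Inhabited Γ]

/-- The configuration that `cfgWord` describes. -/
def cfg (q : S) (l r : List Γ) : TM0.Cfg Γ Λ :=
  ⟨q, Tape.mk' (ListBlank.mk l) (ListBlank.mk r)⟩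

theorem mk_singleton_default : ListBlank.mk [(default : Γ)] = ListBlank.mk [] :=
  (Quotient.sound' (Or.inl ⟨1, rfl⟩)).symm

variable [Inhabited Λ]

/-- The rewriting rules of a Turing machine restricted to the states in `S`. -/
inductive Rule (M : TM0.Machine Γ Λ) (S : Set Λ) : List (Letter Γ S) → List (Letter Γ S) → Prop
  | write {q q' : S} {a b : Γ} : M q a = some (q'.1, .write b) →
      Rule M S [state q, tape a] [state q', tape b]
  | right {q q' : S} {a : Γ} : M q a = some (q'.1, .move .right) →
      Rule M S [state q, tape a] [tape a, state q']
  -- A left move needs a written cell on the left; the padding rules below supply blank cells at the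
  -- borders.
  | left {q q' : S} {a : Γ} (b : Γ) : M q a = some (q'.1, .move .left) →
      Rule M S [tape b, state q, tape a] [state q', tape b, tape a]
  | halt {q : S} {a : Γ} : M q a = none → Rule M S [state q, tape a] [halted]
  | padLeft (q : S) : Rule M S [border, state q] [border, tape default, state q]
  | padRight (q : S) : Rule M S [state q, border] [state q, tape default, border]
  | eraseLeft (s : Letter Γ S) : Rule M S [s, halted] [halted]
  | eraseRight (s : Letter Γ S) : Rule M S [halted, s] [halted]
  | copy (s : Letter Γ S) : Rule M S [s] [s]

/-- The pairs of words that are related by a rule. -/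
abbrev RulePair (M : TM0.Machine Γ Λ) (S : Set Λ) : Type _ :=
  {p : List (Letter Γ S) × List (Letter Γ S) // Rule M S p.1 p.2}

theorem finite_rulePair [Finite Γ] (M : TM0.Machine Γ Λ) (S : Set Λ) [Finite S] :
    Finite (RulePair M S) := by
  refine Set.Finite.subset ((List.finite_length_le (Letter Γ S) 3).prod
    (List.finite_length_le (Letter Γ S) 3)) ?_
  rintro ⟨u, v⟩ (h : Rule M S u v)
  cases h <;> simp

/-- One step with the rules of a Turing machine. -/
abbrev Step (M : TM0.Machine Γ Λ) (S : Set Λ) : List (Letter Γ S) → List (Letter Γ S) → Prop :=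
  RewriteStep (fun i : RulePair M S => i.1.1) (fun i => i.1.2)

variable {M : TM0.Machine Γ Λ}

theorem Rule.step {u v : List (Letter Γ S)} (h : Rule M S u v) (p s : List (Letter Γ S)) :
    Step M S (p ++ u ++ s) (p ++ v ++ s) :=
  ⟨p, ⟨(u, v), h⟩, s, rfl, rfl⟩

theorem step_cfg_cons (q : S) (a : Γ) (l r : List Γ) :
    TM0.step M (cfg q l (a :: r)) = (M q a).map fun p => ⟨p.1, match p.2 with
      | .write c => (cfg q l (c :: r)).Tape
      | .move .right => (cfg q (a :: l) r).Tape
      | .move .left => (cfg q l (a :: r)).Tape.move .left⟩ := by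
  simp only [cfg, TM0.step]
  have : (Tape.mk' (ListBlank.mk l) (ListBlank.mk (a :: r))).1 = a := rfl
  rw [this]
  rcases M q a with _ | ⟨q', d | _⟩
  · rfl
  · cases d <;> rfl
  · rfl

/-- The rules change a word of a configuration into a word of a reachable configuration, unless
the machine halts. -/
theorem reaches_of_step_cfgWord {q : S} {l r : List Γ} {y : List (Letter Γ S)}
    (h : Step M S (cfgWord q l r) y) :
    TM0.step M (cfg q l r) = none ∨
      ∃ q' l' r', y = cfgWord q' l' r' ∧
        StateTransition.Reaches (TM0.step M) (cfg q l r) (cfg q' l' r') := by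
  obtain ⟨p, ⟨⟨u, v⟩, hR⟩, s, hx, rfl⟩ := h
  have hhead : ∀ {a : Γ} {s' : List (Letter Γ S)}, r.map tape ++ [border] = tape a :: s' →
      ∃ r', r = a :: r' ∧ r'.map tape ++ [border] = s' := by
    intro a s' h
    cases r with
    | nil => simp at h
    | cons b r => simpa using h
  cases hR with
  | write hM =>
    simp only [List.append_assoc, List.cons_append, List.nil_append] at hx
    -- The only state letter of the word fixes the place where the rule applies.
    obtain ⟨rfl, rfl, h₂⟩ := eq_of_cfgWord_eq hx
    obtain ⟨r', rfl, rfl⟩ := hhead h₂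
    rename_i q' _ b
    refine Or.inr ⟨q', l, b :: r', by simp [cfgWord], ReflTransGen.single ?_⟩
    rw [step_cfg_cons, hM]
    exact rfl
  | right hM =>
    simp only [List.append_assoc, List.cons_append, List.nil_append] at hx
    obtain ⟨rfl, rfl, h₂⟩ := eq_of_cfgWord_eq hx
    obtain ⟨r', rfl, rfl⟩ := hhead h₂
    rename_i q' a
    refine Or.inr ⟨q', a :: l, r', by simp [cfgWord], ReflTransGen.single ?_⟩
    rw [step_cfg_cons, hM]
    exact rfl
  | left b hM =>
    rename_i q' a
    have hx' := hx.trans (List.append_assoc _ _ _)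
    rw [List.cons_append, ← List.singleton_append, ← List.append_assoc, List.cons_append] at hx'
    obtain ⟨rfl, h₁, h₂⟩ := eq_of_cfgWord_eq hx'
    obtain ⟨r', rfl, rfl⟩ := hhead h₂
    obtain ⟨l', rfl, rfl⟩ : ∃ l', l = b :: l' ∧ border :: l'.reverse.map tape = p := by
      cases l with
      | nil => simpa using congrArg List.getLast? h₁
      | cons c l =>
        rw [List.reverse_cons, List.map_append, ← List.cons_append] at h₁
        have := List.append_inj' h₁ rfl
        exact ⟨l, by simpa using this.2, this.1⟩
    refine Or.inr ⟨q', l', b :: a :: r', by simp [cfgWord], ReflTransGen.single ?_⟩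
    rw [step_cfg_cons, hM]
    exact rfl
  | halt hM =>
    simp only [List.append_assoc, List.cons_append, List.nil_append] at hx
    obtain ⟨rfl, rfl, h₂⟩ := eq_of_cfgWord_eq hx
    obtain ⟨r', rfl, rfl⟩ := hhead h₂
    exact Or.inl (by rw [step_cfg_cons, hM]; rfl)
  | padLeft q' =>
    have hx' := hx.trans (List.append_assoc _ _ _)
    rw [List.cons_append, ← List.singleton_append, ← List.append_assoc, List.cons_append] at hx'
    obtain ⟨rfl, h₁, rfl⟩ := eq_of_cfgWord_eq hx'
    cases l with
    | nil =>
      obtain rfl : p = [] := by simpa using (List.append_inj' (s₁ := []) h₁ rfl).1.symm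
      refine Or.inr ⟨q', [default], r, by simp [cfgWord], ?_⟩
      rw [cfg, cfg, mk_singleton_default]
      exact ReflTransGen.refl
    | cons c l =>
      rw [List.reverse_cons, List.map_append, ← List.cons_append] at h₁
      simpa using (List.append_inj' h₁ rfl).2
  | padRight q' =>
    simp only [List.append_assoc, List.cons_append, List.nil_append] at hx
    obtain ⟨rfl, rfl, h₂⟩ := eq_of_cfgWord_eq hx
    cases r with
    | nil =>
      obtain rfl : s = [] := by simpa using h₂
      refine Or.inr ⟨q', l, [default], by simp [cfgWord], ?_⟩
      rw [cfg, cfg, mk_singleton_default]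
      exact ReflTransGen.refl
    | cons c r => simp at h₂
  | eraseLeft t => exact absurd (hx ▸ by simp) (halted_notMem_cfgWord q l r)
  | eraseRight t => exact absurd (hx ▸ by simp) (halted_notMem_cfgWord q l r)
  | copy t => exact Or.inr ⟨q, l, r, hx.symm, ReflTransGen.refl⟩

/-- Until halting is witnessed, every derived word describes a reachable configuration, and
`[halted]` describes none. -/
theorem eval_dom_of_reflTransGen {q : S} {l r : List Γ}
    (h : ReflTransGen (Step M S) (cfgWord q l r) [halted]) :
    (StateTransition.eval (TM0.step M) (cfg q l r)).Dom := by
  have key : ∀ y, ReflTransGen (Step M S) (cfgWord q l r) y →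
      (StateTransition.eval (TM0.step M) (cfg q l r)).Dom ∨
        ∃ q' l' r', y = cfgWord q' l' r' ∧
          StateTransition.Reaches (TM0.step M) (cfg q l r) (cfg q' l' r') := by
    intro y hy
    induction hy with
    | refl => exact Or.inr ⟨q, l, r, rfl, ReflTransGen.refl⟩
    | tail _ hstep ih =>
      rcases ih with ih | ⟨q', l', r', rfl, hr⟩
      · exact Or.inl ih
      · rcases reaches_of_step_cfgWord hstep with hn | ⟨q'', l'', r'', rfl, hr'⟩
        · exact Or.inl (Part.dom_iff_mem.2 ⟨_, StateTransition.mem_eval.2 ⟨hr, hn⟩⟩)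
        · exact Or.inr ⟨q'', l'', r'', rfl, hr.trans hr'⟩
  rcases key _ h with h | ⟨q', l', r', h, _⟩
  · exact h
  · exact absurd (h ▸ List.mem_singleton_self _) (halted_notMem_cfgWord q' l' r')

theorem reflTransGen_halted (p s : List (Letter Γ S)) :
    ReflTransGen (Step M S) (p ++ halted :: s) [halted] := by
  induction s with
  | nil =>
    induction p using List.reverseRecOn with
    | nil => exact ReflTransGen.refl
    | append_singleton p a ih =>
      refine ReflTransGen.head ?_ ih
      simpa using (Rule.eraseLeft (M := M) a).step p []
  | cons a s ih =>
    refine ReflTransGen.head ?_ ih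
    simpa using (Rule.eraseRight (M := M) a).step p s

/-- With padding, the head of a configuration stands between two written cells. -/
theorem exists_padded (M : TM0.Machine Γ Λ) (q : S) (l r : List Γ) :
    ∃ b l' a r', cfg q l r = cfg q (b :: l') (a :: r') ∧
      ReflTransGen (Step M S) (cfgWord q l r) (cfgWord q (b :: l') (a :: r')) := by
  obtain ⟨b, l', h₁, h₂⟩ : ∃ b l', cfg q l r = cfg q (b :: l') r ∧
      ReflTransGen (Step M S) (cfgWord q l r) (cfgWord q (b :: l') r) := by
    cases l with
    | nil =>
      refine ⟨default, [], by rw [cfg, cfg, mk_singleton_default], ReflTransGen.single ?_⟩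
      simpa [cfgWord] using (Rule.padLeft (M := M) q).step [] (r.map tape ++ [border])
    | cons b l => exact ⟨b, l, rfl, ReflTransGen.refl⟩
  obtain ⟨a, r', h₃, h₄⟩ : ∃ a r', cfg q (b :: l') r = cfg q (b :: l') (a :: r') ∧
      ReflTransGen (Step M S) (cfgWord q (b :: l') r) (cfgWord q (b :: l') (a :: r')) := by
    cases r with
    | nil =>
      refine ⟨default, [], by rw [cfg, cfg, mk_singleton_default], ReflTransGen.single ?_⟩
      simpa [cfgWord] using
        (Rule.padRight (M := M) q).step (border :: (b :: l').reverse.map tape) []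
    | cons a r => exact ⟨a, r, rfl, ReflTransGen.refl⟩
  exact ⟨b, l', a, r', h₁.trans h₃, h₂.trans h₄⟩

/-- Induction along the computation, for all words of a configuration at once, since padding gives
it several. Padding first makes the rule for the next step applicable. -/
theorem reflTransGen_of_eval_dom (hS : TM0.Supports M S) {q : S} {l r : List Γ}
    (h : (StateTransition.eval (TM0.step M) (cfg q l r)).Dom) :
    ReflTransGen (Step M S) (cfgWord q l r) [halted] := by
  obtain ⟨c, hc⟩ := Part.dom_iff_mem.1 h
  obtain ⟨hr, hn⟩ := StateTransition.mem_eval.1 hc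
  generalize hd : cfg q l r = d at hr
  clear h hc
  induction hr using ReflTransGen.head_induction_on generalizing q l r with
  | refl =>
    obtain ⟨b, l', a, r', h₁, h₂⟩ := exists_padded M q l r
    refine h₂.trans ?_
    rw [← hd, h₁, step_cfg_cons, Option.map_eq_none_iff] at hn
    have hs := (Rule.halt hn).step (border :: (b :: l').reverse.map tape) (r'.map tape ++ [border])
    refine ReflTransGen.head (by simpa [cfgWord] using hs) ?_
    simpa using reflTransGen_halted (M := M) (border :: (b :: l').reverse.map tape)
      (r'.map tape ++ [border])
  | head hstep _ ih =>
    obtain ⟨b, l', a, r', h₁, h₂⟩ := exists_padded M q l r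
    refine h₂.trans ?_
    rw [← hd, h₁, step_cfg_cons, Option.mem_def, Option.map_eq_some_iff] at hstep
    obtain ⟨⟨q', act⟩, hM, hc'⟩ := hstep
    obtain ⟨q', rfl⟩ : ∃ q'' : S, q''.1 = q' := ⟨⟨q', hS.2 hM q.2⟩, rfl⟩
    rcases act with (_ | _) | c
    · have hs := (Rule.left b hM).step (border :: l'.reverse.map tape) (r'.map tape ++ [border])
      exact ReflTransGen.head (by simpa [cfgWord] using hs)
        (ih (q := q') (l := l') (r := b :: a :: r') hc')
    · have hs := (Rule.right hM).step (border :: (b :: l').reverse.map tape)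
        (r'.map tape ++ [border])
      exact ReflTransGen.head (by simpa [cfgWord] using hs)
        (ih (q := q') (l := a :: b :: l') (r := r') hc')
    · have hs := (Rule.write hM).step (border :: (b :: l').reverse.map tape)
        (r'.map tape ++ [border])
      exact ReflTransGen.head (by simpa [cfgWord] using hs)
        (ih (q := q') (l := b :: l') (r := c :: r') hc')

/-- A Turing machine halts if and only if the word of its initial configuration can be rewritten
to the halting letter. -/
theorem eval_dom_iff (hS : TM0.Supports M S) (l : List Γ) :
    (TM0.eval M l).Dom ↔
      ReflTransGen (Step M S) (cfgWord (⟨default, hS.1⟩ : S) [] l) [halted] :=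
  ⟨fun h => reflTransGen_of_eval_dom hS h, fun h => eval_dom_of_reflTransGen h⟩

end TMRewriting

/-! ### A Turing machine with undecidable halting problem -/

namespace TMRewriting

open Turing

theorem trNat_eq_map_bits (n : ℕ) :
    PartrecToTM2.trNat n = n.bits.map fun b => cond b .bit1 .bit0 := by
  rw [PartrecToTM2.trNat, ← Num.ofNat'_eq]
  induction n using Nat.binaryRec' with
  | zero => simp [PartrecToTM2.trNum]
  | bit b n h ih =>
    rw [Num.ofNat'_bit, Nat.bits_append_bit n b h, List.map_cons, ← ih]
    cases b with
    | true => cases Num.ofNat' n <;> rfl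
    | false =>
      rcases hn : Num.ofNat' n with _ | p
      · rw [Num.ofNat'_eq] at hn
        have : n = 0 := by simpa using congrArg (fun m : Num => (m : ℕ)) hn
        simpa using h this
      · rfl

theorem computable_bits : Computable Nat.bits := by
  have : Primrec₂ fun (_ : Unit) (n : ℕ) => n.bits := by
    -- `L` lists the values at `0, …, n - 1`: its length is `n`, and its entry at `n / 2` holds the
    -- bits above the lowest one.
    refine Primrec.nat_strong_rec _ (g := fun _ L => if L.length = 0 then some [] else
      (L[L.length / 2]?).map fun t => (L.length % 2 == 1) :: t) ?_ ?_
    · have hlen : Primrec fun p : Unit × List (List Bool) => p.2.length :=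
        Primrec.list_length.comp Primrec.snd
      refine Primrec.ite (Primrec.eq.comp hlen (Primrec.const 0)) (Primrec.const _) ?_
      refine Primrec.option_map
        (Primrec.list_getElem?.comp Primrec.snd (Primrec.nat_div.comp hlen (Primrec.const 2))) ?_
      refine Primrec.list_cons.comp ?_ Primrec.snd
      exact Primrec.beq.comp (Primrec.nat_mod.comp (hlen.comp Primrec.fst) (Primrec.const 2))
        (Primrec.const 1)
    · intro _ n
      rcases Nat.eq_zero_or_pos n with rfl | hn
      · simp
      · have hlt : n / 2 < n := Nat.div_lt_self hn one_lt_two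
        have hb : n = Nat.bit (n % 2 == 1) (n / 2) := by
          rw [Nat.bit_val]
          rcases Nat.mod_two_eq_zero_or_one n with h | h <;> simp [h] <;> omega
        have := Nat.bits_append_bit (n / 2) (n % 2 == 1) (by
          intro h
          have : n = 1 := by omega
          simp [this])
        rw [← hb] at this
        simp [hn.ne', hlt, this]
  exact (this.comp (Primrec.const ()) Primrec.id).to_comp

instance : Finite PartrecToTM2.K' :=
  Finite.of_surjective (fun i : Fin 4 => ![.main, .rev, .aux, .stack] i) (by
    rintro (_ | _ | _ | _)
    exacts [⟨0, rfl⟩, ⟨1, rfl⟩, ⟨2, rfl⟩, ⟨3, rfl⟩])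

/-- The tape letters of the machine with one tape that simulates four stacks. -/
abbrev TapeLetter : Type :=
  TM2to1.Γ' PartrecToTM2.K' fun _ => PartrecToTM2.Γ'

instance : Finite TapeLetter :=
  inferInstanceAs (Finite (Bool × (PartrecToTM2.K' → Option PartrecToTM2.Γ')))

/-- The tape letter with `s` on the main stack only; `b` marks the first cell. -/
def mainLetter (b : Bool) (s : PartrecToTM2.Γ') : TapeLetter :=
  (b, Function.update (fun _ => none) .main (some s))

theorem trInit_trList (n : ℕ) :
    TM2to1.trInit (Γ := fun _ => PartrecToTM2.Γ') .main (PartrecToTM2.trList [n]) =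
      mainLetter true .cons ::
        n.bits.reverse.map fun b => mainLetter false (cond b .bit1 .bit0) := by
  have h : (PartrecToTM2.trList [n]).reverse =
      .cons :: n.bits.reverse.map fun b => cond b .bit1 .bit0 := by
    simp [PartrecToTM2.trList, trNat_eq_map_bits]
  rw [TM2to1.trInit, h]
  exact congrArg (mainLetter true .cons :: ·) List.map_map

/-- A partial recursive function is computed, as far as termination is concerned, by a finite
Turing machine that receives the binary digits of the argument. -/
theorem exists_machine (c : ToPartrec.Code) :
    ∃ (Λ : Type) (_ : Inhabited Λ) (M : TM0.Machine TapeLetter Λ) (S : Set Λ),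
      Finite S ∧ TM0.Supports M S ∧ ∀ n : ℕ,
        (TM0.eval M (TM2to1.trInit .main (PartrecToTM2.trList [n]))).Dom ↔ (c.eval [n]).Dom := by
  -- The default label is the start label, so this instance makes the machine run `c`.
  let _ : Inhabited PartrecToTM2.Λ' := ⟨PartrecToTM2.trNormal c .halt⟩
  have hinit (n : ℕ) : (PartrecToTM2.init c [n] : PartrecToTM2.Cfg') =
      TM2.init .main (PartrecToTM2.trList [n]) := by
    rw [PartrecToTM2.init, TM2.init]
    congr 1
    funext k
    cases k <;> simp [PartrecToTM2.K'.elim, Function.update]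
  have heval (n : ℕ) : (TM2.eval PartrecToTM2.tr .main (PartrecToTM2.trList [n])).Dom ↔
      (c.eval [n]).Dom := by
    have h := PartrecToTM2.tr_eval c [n]
    rw [hinit] at h
    change (StateTransition.eval (TM2.step PartrecToTM2.tr) _).Dom ↔ _
    rw [h]
    exact Iff.rfl
  refine ⟨_, inferInstance, TM1to0.tr (TM2to1.tr PartrecToTM2.tr), _, Finset.finite_toSet _,
    TM1to0.tr_supports _ (TM2to1.tr_supports _ (PartrecToTM2.tr_supports c .halt)), fun n => ?_⟩
  rw [TM1to0.tr_eval]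
  exact (TM2to1.tr_eval_dom PartrecToTM2.tr .main _).trans (heval n)

/-- The function that decodes `n` and runs the result on `0` is partial recursive; deciding its
domain would decide the halting problem. -/
theorem exists_code_not_computablePred :
    ∃ c : ToPartrec.Code, ¬ ComputablePred fun n : ℕ => (c.eval [n]).Dom := by
  have hf : Partrec fun n : ℕ => (Denumerable.ofNat Nat.Partrec.Code n).eval 0 :=
    Nat.Partrec.Code.eval_part.comp (Computable.ofNat _) (Computable.const 0)
  obtain ⟨c, hc⟩ := ToPartrec.Code.exists_code (Nat.Partrec'.part_iff₁.2 hf)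
  refine ⟨c, fun h => ComputablePred.halting_problem 0 ?_⟩
  obtain ⟨f, hf, hp⟩ := ComputablePred.computable_iff.1 h
  refine ComputablePred.computable_iff.2 ⟨_, hf.comp Computable.encode, ?_⟩
  funext p
  have h₁ := congrFun hp (Encodable.encode p)
  have h₂ := hc (Encodable.encode p ::ᵥ List.Vector.nil)
  change c.eval [Encodable.encode p] = _ at h₂
  rw [← h₁, h₂]
  simp

end TMRewriting

/-! ### The reduction -/

open TileDPDA TMRewriting

/-- The words of an automaton whose synchronizing words are the derivations of the word `y` from the
word `x`. -/
def rewritingWords {ι S : Type*} (l r : ι → List S) (x y : List S) :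
    Words (Option ι) (Option S) where
  -- The common leading separator makes the start word of state 0 nonempty, so that the started
  -- phase is visible on the stack.
  start := ![[none], none :: x.map some ++ [none]]
  tile := ![tileWord l, tileWord r]
  final := ![y.map some ++ [none], []]

theorem turnSyncSame_rewritingWords_iff {ι S : Type*} {l r : ι → List S}
    (hcopy : ∀ a, ∃ i, l i = [a] ∧ r i = [a]) (x y : List S) {m g : ℕ}
    (eA : Fin m ≃ Option (Option (Option ι))) (eΓ : Fin g ≃ Option (Option (Option S))) :
    ((rewritingWords l r x y).toDPDA eA eΓ).TurnSyncSame 0 ↔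
      Relation.ReflTransGen (RewriteStep l r) x y := by
  rw [Words.turnSyncSame_toDPDA_iff _ _ _ (by
    intro q
    fin_cases q <;> simp [rewritingWords]), ← exists_tiles_iff hcopy]
  simp [rewritingWords]

/-- Only the first word written by the automaton depends on the word `x`. -/
theorem computable_code_rewritingWords {ι S : Type*} {l r : ι → List S} {x : ℕ → List S}
    (hx : ∀ f : S → ℕ, Computable fun n => (x n).map f) (y : List S) {m g : ℕ}
    (eA : Fin m ≃ Option (Option (Option ι))) (eΓ : Fin g ≃ Option (Option (Option S))) :
    Computable fun n => ((rewritingWords l r (x n) y).toDPDA eA eΓ).code := by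
  refine Computable.pair (Computable.const (2, m, g, ((eΓ.symm none : Fin g) : ℕ))) ?_
  refine Computable.list_ofFn fun q => Computable.list_ofFn fun a => Computable.list_ofFn fun γ => ?_
  -- This is the one entry containing `x n`: state 1 reading the start letter on the bottom symbol.
  by_cases h : q = 1 ∧ eA a = none ∧ eΓ γ = none
  · obtain ⟨rfl, ha, hγ⟩ := h
    have := (hx fun s => ((eΓ.symm (some (some (some s))) : Fin g) : ℕ))
    have hw : Computable fun n => (γ : ℕ) :: ((eΓ.symm (some (some none)) : Fin g) : ℕ) ::
        ((x n).map (fun s => ((eΓ.symm (some (some (some s))) : Fin g) : ℕ)) ++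
          [((eΓ.symm (some (some none)) : Fin g) : ℕ)]) :=
      Computable.list_cons.comp (Computable.const _) (Computable.list_cons.comp (Computable.const _)
        (Computable.list_append.comp this (Computable.const _)))
    refine ((Computable.const 1).pair hw).of_eq fun n => ?_
    have hcast : ∀ L : List (Fin g),
        List.map (fun i : ℕ => i) (do let i ← L; pure (i : ℕ)) = L.map Fin.val := by
      intro L
      simp [List.map_eq_flatMap]
    rw [hcast]
    simp [Words.toDPDA, Words.emit, ha, hγ, rewritingWords, Function.comp_def]
  · have hconst : ∀ n, (rewritingWords l r (x n) y).emit q (eA a) (eΓ γ) =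
        (rewritingWords l r [] y).emit q (eA a) (eΓ γ) := by
      intro n
      rcases hA : eA a with _ | _ | t <;> rcases hΓ : eΓ γ with _ | _ | s <;> try rfl
      have : q = 0 := by
        rw [hA, hΓ] at h
        simp only [and_true] at h
        omega
      subst this
      rfl
    have hδ : ∀ n, ((rewritingWords l r (x n) y).toDPDA eA eΓ).δ q a γ =
        ((rewritingWords l r [] y).toDPDA eA eΓ).δ q a γ := by
      intro n
      simp only [Words.toDPDA, hconst]
    simp only [hδ]
    exact Computable.const _

/-- Between fixed ends, the word is the reversed list of binary digits of `n`, mapped by a function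
on `Bool`. -/
theorem computable_map_cfgWord {Λ : Type*} {S : Set Λ} (q : S) (f : Letter TapeLetter S → ℕ) :
    Computable fun n : ℕ =>
      (cfgWord q [] (Turing.TM2to1.trInit .main (Turing.PartrecToTM2.trList [n]))).map f := by
  let d : Bool → ℕ := fun b => f (.tape (mainLetter false (cond b .bit1 .bit0)))
  have hd : Computable fun n : ℕ => n.bits.reverse.map d :=
    (Primrec.list_map Primrec.id ((Primrec.dom_bool d).comp Primrec.snd).to₂).to_comp.comp
      (Computable.list_reverse.comp computable_bits)
  refine (Computable.list_append.comp
    (Computable.const [f .border, f (.state q), f (.tape (mainLetter true .cons))])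
    (Computable.list_append.comp hd (Computable.const [f .border]))).of_eq fun n => ?_
  rw [trInit_trList]
  simp [cfgWord, Function.comp_def, d]

/-- The problem 0-Turn-Sync-DPDA-Same is undecidable: no computable function, given the description
of a DPDA, decides whether it has a 0-turn synchronizing word in the same stack model. -/
theorem mainTheorem5 :
    ¬ ∃ f : DPDA.Code → Bool, Computable f ∧
      ∀ (k m g : ℕ) (M : DPDA (Fin k) (Fin m) (Fin g)), 0 < k →
        (f M.code = true ↔ M.TurnSyncSame 0) := by
  rintro ⟨f, hf, hspec⟩
  obtain ⟨c, hc⟩ := exists_code_not_computablePred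
  obtain ⟨Λ, _, M, S, _, hS, hM⟩ := exists_machine c
  have := finite_rulePair M S
  obtain ⟨m, ⟨eA⟩⟩ := Finite.exists_equiv_fin (Option (Option (Option (RulePair M S))))
  obtain ⟨g, ⟨eΓ⟩⟩ := Finite.exists_equiv_fin (Option (Option (Option (Letter TapeLetter S))))
  refine hc (ComputablePred.computable_iff.2 ⟨_, hf.comp (computable_code_rewritingWords
    (l := fun i : RulePair M S => i.1.1) (r := fun i => i.1.2)
    (computable_map_cfgWord ⟨default, hS.1⟩) [.halted] eA.symm eΓ.symm), ?_⟩)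
  funext n
  rw [eq_iff_iff, hspec _ _ _ _ two_pos, turnSyncSame_rewritingWords_iff
    (fun s => ⟨⟨([s], [s]), .copy s⟩, rfl, rfl⟩), ← hM n, eval_dom_iff hS]
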